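/- Let $\mathbf{k}$ be a field of characteristic $0$, let $A=\mathbf{k}[x]$ be the polynomial algebra in one variable, and let $T:A\to A$ be the indefinite integral, i.e. the $\mathbf{k}$-linear map with $T(x^n)=\frac{1}{n+1}x^{n+1}$ for all $n\ge 0$. Then $(A,T)$ is a Rota–Baxter algebra of weight $0$, i.e. $T(a)T(b)=T\big(aT(b)+T(a)b\big)$ for all $a,b\in A$, and its cohomology (with coefficients in itself) vanishes: $$\mathrm{H}^n_{\mathrm{RBA}}(A)=0\qquad\text{for all } n\ge 0.$$ Here $\mathrm{H}^\bullet_{\mathrm{RBA}}(A)$ is the cohomology of the following cochain complex, defined for every Rota–Baxter algebra $(A,T)$ of weight $\lambda\in\mathbf{k}$, that is, an associative algebra $A$ with a linear map $T$ such that $T(a)T(b)=T(aT(b)+T(a)b+\lambda ab)$. Let $(\mathrm{C}^\bullet_{\mathrm{Alg}}(A),\delta)$ be the Hochschild complex of $A$, with $\mathrm{C}^n_{\mathrm{Alg}}(A)=\mathrm{Hom}_{\mathbf{k}}(A^{\otimes n},A)$ and $$\delta^n f(a_1,\dots,a_{n+1})=(-1)^{n+1}a_1f(a_2,\dots,a_{n+1})+\sum_{i=1}^n(-1)^{n-i+1}f(a_1,\dots,a_ia_{i+1},\dots,a_{n+1})+f(a_1,\dots,a_n)a_{n+1}.$$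 Let $A_\star$ be the space $A$ with the associative product $a\star b=aT(b)+T(a)b+\lambda ab$; it acts on $A$ from the left and from the right by $a\rhd m=T(a)m-T(am)$ and $m\lhd a=mT(a)-T(ma)$. Let $(\mathrm{C}^\bullet_{\mathrm{RBO}}(A),\partial)$ be the Hochschild complex of $A_\star$ with coefficients in this bimodule, so $\mathrm{C}^n_{\mathrm{RBO}}(A)=\mathrm{Hom}_{\mathbf{k}}(A^{\otimes n},A)$ and $\partial^n$ is given by the same formula as $\delta^n$ with $\star$, $\rhd$, $\lhd$ in place of the products. Let $\Phi^0=\mathrm{Id}$ and, for $n\ge1$, $$\Phi^n(f)(a_1,\dots,a_n)=f(T(a_1),\dots,T(a_n))-\sum_{S\subsetneq\{1,\dots,n\}}\lambda^{n-1-|S|}\,T\big(f(b^S_1,\dots,b^S_n)\big),$$ where $b^S_i=T(a_i)$ if $i\in S$ and $b^S_i=a_i$ otherwise (and $\lambda^0=1$). Then $\mathrm{C}^0_{\mathrm{RBA}}(A)=\mathrm{C}^0_{\mathrm{Alg}}(A)$ and $\mathrm{C}^n_{\mathrm{RBA}}(A)=\mathrm{C}^n_{\mathrm{Alg}}(A)\oplus\mathrm{C}^{n-1}_{\mathrm{RBO}}(A)$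 for $n\ge1$, with differential $d^0(f)=(\delta^0f,-f)$ and $d^n(f,g)=(\delta^nf,\,-\partial^{n-1}g-\Phi^nf)$ for $n\ge 1$. -/

import Mathlib

open Polynomial

noncomputable section

namespace RotaBaxter

/-! ### Hochschild cochains and the Hochschild differential -/

section Hochschild

variable {k A M : Type*} [CommRing k] [AddCommGroup A] [Module k A] [AddCommGroup M] [Module k M]

variable (k A M) in
/-- The space of Hochschild `n`-cochains `Hom(A^{⊗ n}, M)`, a linear map out of the tensor power
being the same as a `k`-multilinear map in `n` variables. -/
abbrev Cochain (n : ℕ) : Type _ := MultilinearMap k (fun _ : Fin n => A) M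

/-- Changing one variable of `a` changes exactly one entry of
`(a₁, …, aᵢ ⬝ aᵢ₊₁, …, aₙ₊₁)`, in a linear way. -/
theorem exists_contractNth_update (m : A →ₗ[k] A →ₗ[k] A) {n : ℕ} (i : Fin n)
    (a : Fin (n + 1) → A) (j : Fin (n + 1)) :
    ∃ (j' : Fin n) (φ : A →ₗ[k] A), ∀ x : A,
      Fin.contractNth i.castSucc (fun u v => m u v) (Function.update a j x) =
        Function.update (Fin.contractNth i.castSucc (fun u v => m u v) a) j' (φ x) := by
  obtain h | h | h | h : (j : ℕ) < i ∨ (j : ℕ) = i ∨ (j : ℕ) = i + 1 ∨ (i : ℕ) + 1 < j := by omega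
  · refine ⟨⟨j, by omega⟩, LinearMap.id, fun x => ?_⟩
    ext l
    simp only [Fin.contractNth, Function.update_apply, Fin.ext_iff, Fin.val_castSucc, Fin.val_succ,
      LinearMap.id_apply]
    split_ifs <;> first | rfl | omega
  · refine ⟨i, m.flip (a i.succ), fun x => ?_⟩
    ext l
    simp only [Fin.contractNth, Function.update_apply, Fin.ext_iff, Fin.val_castSucc, Fin.val_succ,
      LinearMap.flip_apply]
    split_ifs with h1 h2 h3 h4 h5 <;> first | rfl | omega | skip
    all_goals
      obtain rfl : l = i := Fin.ext (by omega)
      rfl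
  · refine ⟨i, m (a i.castSucc), fun x => ?_⟩
    ext l
    simp only [Fin.contractNth, Function.update_apply, Fin.ext_iff, Fin.val_castSucc, Fin.val_succ]
    split_ifs with h1 h2 h3 h4 h5 <;> first | rfl | omega | skip
    all_goals
      obtain rfl : l = i := Fin.ext (by omega)
      rfl
  · refine ⟨⟨j - 1, by omega⟩, LinearMap.id, fun x => ?_⟩
    ext l
    simp only [Fin.contractNth, Function.update_apply, Fin.ext_iff, Fin.val_castSucc, Fin.val_succ,
      LinearMap.id_apply]
    split_ifs <;> first | rfl | omega

/-- The multilinear map `(a₁, …, aₙ₊₁) ↦ f(a₁, …, aᵢ ⬝ aᵢ₊₁, …, aₙ₊₁)`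
(with `i` counted from zero). -/
def Cochain.contract (m : A →ₗ[k] A →ₗ[k] A) {n : ℕ} (i : Fin n) (f : Cochain k A M n) :
    Cochain k A M (n + 1) :=
  MultilinearMap.mk' (fun a => f (Fin.contractNth i.castSucc (fun u v => m u v) a))
    (fun a j x y => by
      obtain ⟨j', φ, h⟩ := exists_contractNth_update m i a j
      simp only [h, map_add, MultilinearMap.map_update_add])
    (fun a j c x => by
      obtain ⟨j', φ, h⟩ := exists_contractNth_update m i a j
      simp only [h, map_smul, MultilinearMap.map_update_smul])

/-- The multilinear map `(a₁, …, aₙ₊₁) ↦ a₁ ⬝ f(a₂, …, aₙ₊₁)`. -/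
def Cochain.left (l : A →ₗ[k] M →ₗ[k] M) {n : ℕ} (f : Cochain k A M n) : Cochain k A M (n + 1) :=
  LinearMap.uncurryLeft
    ({ toFun := fun a => (l a).compMultilinearMap f
       map_add' := fun x y => by ext v; simp
       map_smul' := fun c x => by ext v; simp } :
      A →ₗ[k] MultilinearMap k (fun _ : Fin n => A) M)

/-- The multilinear map `(a₁, …, aₙ₊₁) ↦ f(a₁, …, aₙ) ⬝ aₙ₊₁`. -/
def Cochain.right (r : M →ₗ[k] A →ₗ[k] M) {n : ℕ} (f : Cochain k A M n) : Cochain k A M (n + 1) :=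
  MultilinearMap.uncurryRight (M := fun _ : Fin (n + 1) => A) (r.compMultilinearMap f)

/-- The Hochschild differential `Hom(A^{⊗ n}, M) → Hom(A^{⊗ (n+1)}, M)` of the algebra `A` with
product `m` and coefficients in the bimodule `M` with left action `l` and right action `r`. -/
def hochschildD (m : A →ₗ[k] A →ₗ[k] A) (l : A →ₗ[k] M →ₗ[k] M) (r : M →ₗ[k] A →ₗ[k] M) (n : ℕ) :
    Cochain k A M n →ₗ[k] Cochain k A M (n + 1) where
  toFun f := (-1 : k) ^ (n + 1) • f.left l
    + ∑ i : Fin n, (-1 : k) ^ (n - (i : ℕ)) • f.contract m i + f.right r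
  map_add' f g := by
    ext a
    simp [Cochain.left, Cochain.right, Cochain.contract, LinearMap.uncurryLeft_apply,
      Finset.sum_add_distrib]
    abel
  map_smul' c f := by
    ext a
    simp [Cochain.left, Cochain.right, Cochain.contract, LinearMap.uncurryLeft_apply,
      Finset.smul_sum, smul_comm c]

/-- The usual formula: `(δf)(a₁, …, aₙ₊₁) = (-1)ⁿ⁺¹ a₁ f(a₂, …, aₙ₊₁)
+ ∑ᵢ (-1)ⁿ⁻ⁱ⁺¹ f(a₁, …, aᵢ aᵢ₊₁, …, aₙ₊₁) + f(a₁, …, aₙ) aₙ₊₁`; here the index `i` starts at `0`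
instead of `1`. -/
theorem hochschildD_apply (m : A →ₗ[k] A →ₗ[k] A) (l : A →ₗ[k] M →ₗ[k] M)
    (r : M →ₗ[k] A →ₗ[k] M) (n : ℕ) (f : Cochain k A M n) (a : Fin (n + 1) → A) :
    hochschildD m l r n f a = (-1 : k) ^ (n + 1) • l (a 0) (f (fun j => a j.succ))
      + ∑ i : Fin n, (-1 : k) ^ (n - (i : ℕ)) •
          f (Fin.contractNth i.castSucc (fun u v => m u v) a)
      + r (f (fun j => a j.castSucc)) (a (Fin.last n)) := by
  simp [hochschildD, Cochain.left, Cochain.right, Cochain.contract, LinearMap.uncurryLeft_apply]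
  rfl

end Hochschild

/-! ### Rota–Baxter algebras and their cohomology (with coefficients in the regular bimodule) -/

section Cohomology

variable {k A : Type*} [CommRing k] [NonUnitalRing A] [Module k A] [SMulCommClass k A A]
  [IsScalarTower k A A]

/-- `T` is a Rota–Baxter operator of weight `w` on the associative algebra `A`. -/
def IsRotaBaxterOperator (w : k) (T : A →ₗ[k] A) : Prop :=
  ∀ a b : A, T a * T b = T (a * T b + T a * b + w • (a * b))

/-- The product `a ⋆ b = a T(b) + T(a) b + w a b` of the algebra `A_⋆`. -/
def starMul (w : k) (T : A →ₗ[k] A) : A →ₗ[k] A →ₗ[k] A :=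
  LinearMap.mk₂ k (fun a b => a * T b + T a * b + w • (a * b))
    (fun a a' b => by simp only [map_add, add_mul, smul_add]; abel)
    (fun c a b => by simp only [map_smul, smul_mul_assoc, smul_add, smul_comm c])
    (fun a b b' => by simp only [map_add, mul_add, smul_add]; abel)
    (fun c a b => by simp only [map_smul, mul_smul_comm, smul_add, smul_comm c])

/-- The left action `a ▷ x = T(a) x - T(a x)` of `A_⋆` on `A`. -/
def leftAct (T : A →ₗ[k] A) : A →ₗ[k] A →ₗ[k] A :=
  LinearMap.mk₂ k (fun a x => T a * x - T (a * x))
    (fun a a' x => by simp only [map_add, add_mul]; abel)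
    (fun c a x => by simp only [map_smul, smul_mul_assoc, smul_sub])
    (fun a x x' => by simp only [map_add, mul_add]; abel)
    (fun c a x => by simp only [map_smul, mul_smul_comm, smul_sub])

/-- The right action `x ◁ a = x T(a) - T(x a)` of `A_⋆` on `A`. -/
def rightAct (T : A →ₗ[k] A) : A →ₗ[k] A →ₗ[k] A :=
  LinearMap.mk₂ k (fun x a => x * T a - T (x * a))
    (fun x x' a => by simp only [map_add, add_mul]; abel)
    (fun c x a => by simp only [map_smul, smul_mul_assoc, smul_sub])
    (fun x a a' => by simp only [map_add, mul_add]; abel)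
    (fun c x a => by simp only [map_smul, mul_smul_comm, smul_sub])

variable (k A) in
/-- The differential `δⁿ` of the Hochschild cochain complex `C_Alg(A)` of the algebra `A`. -/
def dAlg (n : ℕ) : Cochain k A A n →ₗ[k] Cochain k A A (n + 1) :=
  hochschildD (LinearMap.mul k A) (LinearMap.mul k A) (LinearMap.mul k A) n

/-- The differential `∂ⁿ` of the cochain complex `C_RBO(A)` of the Rota–Baxter operator `T`: the
Hochschild differential of `A_⋆` with coefficients in `A` with the actions `▷` and `◁`. -/
def dRBO (w : k) (T : A →ₗ[k] A) (n : ℕ) : Cochain k A A n →ₗ[k] Cochain k A A (n + 1) :=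
  hochschildD (starMul w T) (leftAct T) (rightAct T) n

/-- The map `Φⁿ : C_Alg(A) → C_RBO(A)`,
`Φⁿ(f)(a₁, …, aₙ) = f(T a₁, …, T aₙ) - ∑_S w^{n-1-|S|} T(f(b₁, …, bₙ))`, where `S` runs over the
proper subsets of the set of indices, `bᵢ = T aᵢ` for `i ∈ S` and `bᵢ = aᵢ` for `i ∉ S`. For `n = 0`
there is no proper subset and `Φ⁰` is the identity. -/
def Phi (w : k) (T : A →ₗ[k] A) (n : ℕ) : Cochain k A A n →ₗ[k] Cochain k A A n :=
  MultilinearMap.compLinearMapₗ (fun _ => T) -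
    ∑ S ∈ (Finset.univ : Finset (Fin n)).ssubsets, w ^ (n - 1 - S.card) •
      (LinearMap.compMultilinearMapₗ k T ∘ₗ
        MultilinearMap.compLinearMapₗ (fun i => if i ∈ S then T else LinearMap.id))

set_option linter.unusedSectionVars false in
theorem Phi_apply (w : k) (T : A →ₗ[k] A) (n : ℕ) (f : Cochain k A A n) (a : Fin n → A) :
    Phi w T n f a = f (fun i => T (a i)) -
      ∑ S ∈ (Finset.univ : Finset (Fin n)).ssubsets,
        w ^ (n - 1 - S.card) • T (f (fun i => if i ∈ S then T (a i) else a i)) := by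
  have h : ∀ (S : Finset (Fin n)) (i : Fin n),
      (if i ∈ S then T else LinearMap.id) (a i) = if i ∈ S then T (a i) else a i := by
    intro S i; split_ifs <;> rfl
  simp [Phi, h]

theorem Phi_zero (w : k) (T : A →ₗ[k] A) : Phi w T 0 = LinearMap.id := by
  have h : (Finset.univ : Finset (Fin 0)).ssubsets = ∅ := by decide
  ext f a
  rw [Phi_apply, h]
  simp [Subsingleton.elim (fun i => T (a i)) a]

variable (k A) in
/-- The cochain spaces of the Rota–Baxter algebra: `C⁰_RBA(A) = C⁰_Alg(A)` and
`Cⁿ_RBA(A) = Cⁿ_Alg(A) ⊕ Cⁿ⁻¹_RBO(A)` for `n ≥ 1`. -/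
def RBACochain : ℕ → Type _
  | 0 => Cochain k A A 0
  | n + 1 => Cochain k A A (n + 1) × Cochain k A A n

instance instAddCommGroupRBACochain : ∀ n : ℕ, AddCommGroup (RBACochain k A n)
  | 0 => inferInstanceAs (AddCommGroup (Cochain k A A 0))
  | n + 1 => inferInstanceAs (AddCommGroup (Cochain k A A (n + 1) × Cochain k A A n))

instance instModuleRBACochain : ∀ n : ℕ, Module k (RBACochain k A n)
  | 0 => inferInstanceAs (Module k (Cochain k A A 0))
  | n + 1 => inferInstanceAs (Module k (Cochain k A A (n + 1) × Cochain k A A n))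

/-- The differential of the Rota–Baxter algebra `(A, T)` of weight `w`,
`dⁿ(f, g) = (δⁿ f, -∂ⁿ⁻¹ g - Φⁿ f)`, without the `g`-terms for `n = 0`: the negative shift of the
mapping cone of `Φ`. -/
def dRBA (w : k) (T : A →ₗ[k] A) : ∀ n : ℕ, RBACochain k A n →ₗ[k] RBACochain k A (n + 1)
  | 0 => ((dAlg k A 0).prod (-Phi w T 0) :
      Cochain k A A 0 →ₗ[k] Cochain k A A 1 × Cochain k A A 0)
  | n + 1 => ((dAlg k A (n + 1) ∘ₗ LinearMap.fst k _ _).prod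
        (-(dRBO w T n ∘ₗ LinearMap.snd k _ _) - Phi w T (n + 1) ∘ₗ LinearMap.fst k _ _) :
      Cochain k A A (n + 1) × Cochain k A A n →ₗ[k]
        Cochain k A A (n + 2) × Cochain k A A (n + 1))

/-- The `n`-cocycles. -/
def RBACocycles (w : k) (T : A →ₗ[k] A) (n : ℕ) : Submodule k (RBACochain k A n) :=
  LinearMap.ker (dRBA w T n)

/-- The `n`-coboundaries; there are none but zero in degree `0`. -/
def RBACoboundaries (w : k) (T : A →ₗ[k] A) : ∀ n : ℕ, Submodule k (RBACochain k A n)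
  | 0 => ⊥
  | n + 1 => LinearMap.range (dRBA w T n)

/-- The cohomology `Hⁿ_RBA(A)` of the Rota–Baxter algebra `(A, T)` of weight `w`: cocycles modulo
coboundaries. -/
abbrev RBACohomology (w : k) (T : A →ₗ[k] A) (n : ℕ) : Type _ :=
  ↥(RBACocycles w T n) ⧸ (RBACoboundaries w T n).submoduleOf (RBACocycles w T n)

end Cohomology

/-! ### The integration operator -/

/-- The indefinite integral on `k[x]`, `xⁿ ↦ xⁿ⁺¹ / (n + 1)`. -/
def integration (k : Type*) [Field k] : k[X] →ₗ[k] k[X] :=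
  Polynomial.lsum fun n => ((n : k) + 1)⁻¹ • Polynomial.monomial (n + 1)

theorem integration_X_pow (k : Type*) [Field k] (n : ℕ) :
    integration k (X ^ n) = (1 / ((n : k) + 1)) • (X ^ (n + 1) : k[X]) := by
  simp [integration, Polynomial.lsum_apply, ← Polynomial.monomial_one_right_eq_X_pow]

end RotaBaxter

end

/-!
The complex of the Rota–Baxter algebra is a shifted mapping cone of `Φ`, so the claim is that `Φ`
is a quasi-isomorphism from the Hochschild complex of `k[x]` to that of `k[x]_⋆` with coefficients
in `k[x]`.

In both complexes the cohomology vanishes in degrees at least two, because both algebras have a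
basis of powers of one element: `1, x, x², …` for `k[x]`, and `1, 2x, 3x², …` for `k[x]_⋆`, which
is non-unital and generated by `1`. For such an algebra with generator `g`, a recursion along the
basis in the first argument gives a cochain `h` such that `f - δh` vanishes when its first argument
is `g`, and a cocycle with this property is zero (`exists_hochschildD_eq_of_powers`). In the
unital case the cocycle is first normalised to vanish when its first argument is the unit
(`exists_hochschildD_eq_of_unital_powers`).

In low degrees, the differentials `δ⁰` and `∂⁰` vanish by commutativity and `Φ⁰` is the identity.
The `1`-cocycles of `k[x]` are the derivations `p · d/dx`, those of `k[x]_⋆` are determined by their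
value at `1`, and `Φ(p · d/dx)` takes the value `p` at `1`; so `Φ` is bijective on `1`-cocycles
(`eq_zero_of_Phi_one_eq_zero`, `Phi_derivCochain_eq`).

The general facts `δδ = 0`, `∂∂ = 0` and, in weight zero, `∂Φ = Φδ` are proved by induction on
the degree, with `curryLeft_hochschildD`: freezing the first argument of `δf` at `a` gives the
differential of `f(a, …)` with left action zero, up to explicit terms.
-/

noncomputable section

namespace RotaBaxter

/-! ### A recursion for the Hochschild differential -/

section Contract

variable {A : Type*}

theorem contractNth_zero_cons (op : A → A → A) {n : ℕ} (a : A) (b : Fin (n + 1) → A) :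
    Fin.contractNth (Fin.castSucc (0 : Fin (n + 1))) op (Fin.cons a b : Fin (n + 2) → A) =
      (Fin.cons (op a (b 0)) (Fin.tail b) : Fin (n + 1) → A) := by
  funext j
  refine Fin.cases ?_ (fun j => ?_) j
  · simp [Fin.contractNth]
  · simp [Fin.contractNth, Fin.tail]

theorem contractNth_succ_cons (op : A → A → A) {n : ℕ} (i : Fin n) (a : A) (b : Fin (n + 1) → A) :
    Fin.contractNth i.succ.castSucc op (Fin.cons a b : Fin (n + 2) → A) =
      (Fin.cons a (Fin.contractNth i.castSucc op b) : Fin (n + 1) → A) := by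
  funext j
  refine Fin.cases ?_ (fun j => ?_) j
  · simp [Fin.contractNth]
  · simp only [Fin.contractNth, Fin.cons_succ, Fin.val_succ, Fin.val_castSucc,
      Nat.add_lt_add_iff_right, Nat.add_right_cancel_iff, Fin.castSucc_succ]

theorem comp_contractNth {A' : Type*} (op : A → A → A) (op' : A' → A' → A') (α : A' → A)
    (hα : ∀ a b, α (op' a b) = op (α a) (α b)) {n : ℕ} (i : Fin n) (a : Fin (n + 1) → A') :
    (fun j => α (Fin.contractNth i.castSucc op' a j)) =
      Fin.contractNth i.castSucc op (fun j => α (a j)) := by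
  funext j
  simp only [Fin.contractNth]
  split_ifs <;> simp [hα]

end Contract

section Hochschild

variable {k A M : Type*} [CommRing k] [AddCommGroup A] [Module k A] [AddCommGroup M] [Module k M]

/-- The cochain `(b₁, …, bₙ₊₁) ↦ f(a ⬝ b₁, b₂, …, bₙ₊₁)`. -/
def Cochain.mulFirst (m : A →ₗ[k] A →ₗ[k] A) (a : A) {n : ℕ} (f : Cochain k A M (n + 1)) :
    Cochain k A M (n + 1) :=
  LinearMap.uncurryLeft (f.curryLeft ∘ₗ m a)

theorem curryLeft_mulFirst (m : A →ₗ[k] A →ₗ[k] A) (a b : A) {n : ℕ}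
    (f : Cochain k A M (n + 1)) :
    (f.mulFirst m a).curryLeft b = f.curryLeft (m a b) := by
  ext v
  simp [Cochain.mulFirst]

theorem cochain_ext_curryLeft {n : ℕ} {f g : Cochain k A M (n + 1)}
    (h : ∀ a, f.curryLeft a = g.curryLeft a) : f = g := by
  ext v
  have := DFunLike.congr_fun (h (v 0)) (Fin.tail v)
  simpa using this

/-- Freezing the first argument of `δf` at `a` gives `±(a ⬝ f - f(a ⬝ -, …))` plus the differential
of `f(a, -, …)` for the left action zero. This reduces statements about `δ` to a smaller degree, at
the price of killing the left action. -/
theorem curryLeft_hochschildD (m : A →ₗ[k] A →ₗ[k] A) (l : A →ₗ[k] M →ₗ[k] M)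
    (r : M →ₗ[k] A →ₗ[k] M) {n : ℕ} (f : Cochain k A M (n + 1)) (a : A) :
    (hochschildD m l r (n + 1) f).curryLeft a =
      (-1 : k) ^ n • ((l a).compMultilinearMap f - f.mulFirst m a) +
        hochschildD m 0 r n (f.curryLeft a) := by
  ext b
  have hl : (fun j : Fin (n + 1) => (Fin.cons a b : Fin (n + 2) → A) j.castSucc) =
      (Fin.cons a (fun j : Fin n => b j.castSucc) : Fin (n + 1) → A) := by
    funext j
    refine Fin.cases ?_ (fun j => ?_) j <;> simp
  simp only [MultilinearMap.curryLeft_apply, hochschildD_apply, add_apply,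
    smul_apply, sub_apply, LinearMap.compMultilinearMap_apply,
    Fin.sum_univ_succ, contractNth_zero_cons, contractNth_succ_cons, Fin.cons_zero, Fin.cons_succ,
    Cochain.mulFirst, LinearMap.uncurryLeft_apply, LinearMap.comp_apply, LinearMap.zero_apply,
    smul_zero, hl, Fin.val_zero, Fin.val_succ, Nat.add_sub_add_right, Nat.sub_zero]
  rw [← Fin.succ_last, Fin.cons_succ]
  rw [pow_add, pow_add, pow_one, smul_sub]
  simp
  abel

theorem hochschildD_zero_apply (m : A →ₗ[k] A →ₗ[k] A) (l : A →ₗ[k] M →ₗ[k] M)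
    (r : M →ₗ[k] A →ₗ[k] M) (f : Cochain k A M 0) (a : Fin 1 → A) (v : Fin 0 → A) :
    hochschildD m l r 0 f a = r (f v) (a 0) - l (a 0) (f v) := by
  rw [hochschildD_apply, Subsingleton.elim (fun j : Fin 0 => a j.succ) v,
    Subsingleton.elim (fun j : Fin 0 => a j.castSucc) v]
  simp
  abel

/-- The left action enters the Hochschild differential only through `a₁ f(a₂, …)`. -/
theorem hochschildD_eq_left_add (m : A →ₗ[k] A →ₗ[k] A) (l : A →ₗ[k] M →ₗ[k] M)
    (r : M →ₗ[k] A →ₗ[k] M) {n : ℕ} (f : Cochain k A M n) (a : A) :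
    (hochschildD m l r n f).curryLeft a =
      (-1 : k) ^ (n + 1) • (l a).compMultilinearMap f + (hochschildD m 0 r n f).curryLeft a := by
  ext b
  simp [hochschildD_apply, add_assoc]

/-- Hochschild differentials are natural in the algebra and in the coefficients. -/
theorem hochschildD_naturality {A' M' : Type*} [AddCommGroup A'] [Module k A'] [AddCommGroup M']
    [Module k M'] {m : A →ₗ[k] A →ₗ[k] A} {l : A →ₗ[k] M →ₗ[k] M} {r : M →ₗ[k] A →ₗ[k] M}
    {m' : A' →ₗ[k] A' →ₗ[k] A'} {l' : A' →ₗ[k] M' →ₗ[k] M'} {r' : M' →ₗ[k] A' →ₗ[k] M'}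
    (α : A' →ₗ[k] A) (φ : M →ₗ[k] M') (hm : ∀ a b, α (m' a b) = m (α a) (α b))
    (hl : ∀ a x, l' a (φ x) = φ (l (α a) x)) (hr : ∀ x a, r' (φ x) a = φ (r x (α a)))
    {n : ℕ} (f : Cochain k A M n) :
    hochschildD m' l' r' n (φ.compMultilinearMap (f.compLinearMap fun _ => α)) =
      φ.compMultilinearMap ((hochschildD m l r n f).compLinearMap fun _ => α) := by
  ext a
  simp only [LinearMap.compMultilinearMap_apply, MultilinearMap.compLinearMap_apply,
    hochschildD_apply, hl, hr, map_add, map_sum, map_smul]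
  congr! 5 with i
  exact congrArg f (comp_contractNth (fun u v => m u v) (fun u v => m' u v) α hm i a)

/-- Postcomposition with a map of right modules commutes with the differential for the zero left
action. -/
theorem hochschildD_zero_comp (m : A →ₗ[k] A →ₗ[k] A) (r : M →ₗ[k] A →ₗ[k] M) (φ : M →ₗ[k] M)
    (h : ∀ x a, r (φ x) a = φ (r x a)) {n : ℕ} (f : Cochain k A M n) :
    hochschildD m 0 r n (φ.compMultilinearMap f) =
      φ.compMultilinearMap (hochschildD m 0 r n f) :=
  hochschildD_naturality (m := m) (m' := m) (l := 0) (l' := 0) (r := r) LinearMap.id φ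
    (fun _ _ => rfl) (by simp) h f

theorem hochschildD_zero_mulFirst (m : A →ₗ[k] A →ₗ[k] A) (r : M →ₗ[k] A →ₗ[k] M)
    (hm : ∀ a b c, m (m a b) c = m a (m b c)) {n : ℕ} (f : Cochain k A M (n + 1)) (a : A) :
    hochschildD m 0 r (n + 1) (f.mulFirst m a) =
      (hochschildD m 0 r (n + 1) f).mulFirst m a := by
  refine cochain_ext_curryLeft fun b => ?_
  rw [curryLeft_mulFirst, curryLeft_hochschildD, curryLeft_hochschildD, curryLeft_mulFirst]
  congr 3
  refine cochain_ext_curryLeft fun c => ?_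
  simp only [curryLeft_mulFirst, hm]

theorem hochschildD_zero_hochschildD_zero (m : A →ₗ[k] A →ₗ[k] A) (r : M →ₗ[k] A →ₗ[k] M)
    (hm : ∀ a b c, m (m a b) c = m a (m b c)) (hr : ∀ x a b, r (r x a) b = r x (m a b))
    (n : ℕ) (f : Cochain k A M n) :
    hochschildD m 0 r (n + 1) (hochschildD m 0 r n f) = 0 := by
  induction n with
  | zero =>
    refine cochain_ext_curryLeft fun a => ?_
    rw [curryLeft_hochschildD]
    ext b
    simp [hochschildD_zero_apply _ _ _ _ _ Fin.elim0, Cochain.mulFirst, hr]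
  | succ n ih =>
    refine cochain_ext_curryLeft fun a => ?_
    rw [curryLeft_hochschildD, curryLeft_hochschildD, map_add, ih, map_smul, map_sub,
      hochschildD_zero_mulFirst m r hm]
    ext b
    simp [pow_succ]

/-- The Hochschild differential of an associative algebra with coefficients in a bimodule squares
to zero. -/
theorem hochschildD_hochschildD (m : A →ₗ[k] A →ₗ[k] A) (l : A →ₗ[k] M →ₗ[k] M)
    (r : M →ₗ[k] A →ₗ[k] M) (hm : ∀ a b c, m (m a b) c = m a (m b c))
    (hl : ∀ a b x, l (m a b) x = l a (l b x)) (hr : ∀ x a b, r (r x a) b = r x (m a b))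
    (hlr : ∀ a x b, r (l a x) b = l a (r x b)) (n : ℕ) (f : Cochain k A M n) :
    hochschildD m l r (n + 1) (hochschildD m l r n f) = 0 := by
  refine cochain_ext_curryLeft fun a => ?_
  cases n with
  | zero =>
    rw [curryLeft_hochschildD]
    ext b
    simp [hochschildD_zero_apply _ _ _ _ _ Fin.elim0, Cochain.mulFirst, hr, hl, hlr]
  | succ n =>
    rw [curryLeft_hochschildD, curryLeft_hochschildD, map_add,
      hochschildD_zero_hochschildD_zero m r hm hr, map_smul, map_sub,
      hochschildD_zero_comp m r (l a) (hlr a), hochschildD_zero_mulFirst m r hm]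
    refine cochain_ext_curryLeft fun b => ?_
    have h1 : ∀ c, ((hochschildD m l r (n + 1) f).curryLeft c) =
      (-1 : k) ^ (n + 2) • (l c).compMultilinearMap f + (hochschildD m 0 r (n + 1) f).curryLeft c :=
      hochschildD_eq_left_add m l r f
    ext v
    have h2 := fun c => DFunLike.congr_fun (h1 c) v
    simp only [MultilinearMap.curryLeft_apply, add_apply, smul_apply,
      LinearMap.compMultilinearMap_apply] at h2
    simp [h2, pow_succ, Cochain.mulFirst, hl]

end Hochschild

/-! ### The cochain map `Φ` in weight zero -/

section Operators

variable {k A : Type*} [CommRing k] [NonUnitalRing A] [Module k A] [SMulCommClass k A A]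
  [IsScalarTower k A A]

theorem dAlg_dAlg (n : ℕ) (f : Cochain k A A n) : dAlg k A (n + 1) (dAlg k A n f) = 0 :=
  hochschildD_hochschildD _ _ _ (by simp [mul_assoc]) (by simp [mul_assoc])
    (by simp [mul_assoc]) (by simp [mul_assoc]) n f

@[simp] theorem starMul_apply (w : k) (T : A →ₗ[k] A) (a b : A) :
    starMul w T a b = a * T b + T a * b + w • (a * b) := rfl

@[simp] theorem leftAct_apply (T : A →ₗ[k] A) (a x : A) :
    leftAct T a x = T a * x - T (a * x) := rfl

@[simp] theorem rightAct_apply (T : A →ₗ[k] A) (x a : A) :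
    rightAct T x a = x * T a - T (x * a) := rfl

theorem IsRotaBaxterOperator.map_starMul {w : k} {T : A →ₗ[k] A} (hT : IsRotaBaxterOperator w T)
    (a b : A) : T (starMul w T a b) = T a * T b := (hT a b).symm

theorem IsRotaBaxterOperator.dRBO_dRBO {w : k} {T : A →ₗ[k] A} (hT : IsRotaBaxterOperator w T)
    (n : ℕ) (f : Cochain k A A n) : dRBO w T (n + 1) (dRBO w T n f) = 0 := by
  refine hochschildD_hochschildD _ _ _ (fun a b c => ?_) (fun a b x => ?_) (fun x a b => ?_)
    (fun a x b => ?_) n f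
  · rw [starMul_apply, hT.map_starMul, starMul_apply w T a (starMul w T b c), hT.map_starMul]
    simp only [starMul_apply, mul_add, add_mul, smul_add, mul_assoc, smul_mul_assoc,
      mul_smul_comm]
    abel
  · simp only [leftAct_apply, hT.map_starMul]
    rw [mul_sub, hT a (b * x)]
    simp only [starMul_apply, mul_sub, add_mul, mul_assoc, map_sub, map_add, map_smul,
      smul_mul_assoc]
    abel
  · simp only [rightAct_apply, hT.map_starMul]
    rw [sub_mul, hT (x * a) b]
    simp only [starMul_apply, sub_mul, mul_add, mul_assoc, map_sub, map_add, map_smul,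
      mul_smul_comm]
    abel
  · simp only [rightAct_apply, leftAct_apply]
    rw [sub_mul, mul_sub, hT (a * x) b, hT a (x * b)]
    simp only [sub_mul, mul_sub, mul_assoc, map_sub, map_add, map_smul]
    abel

/-- In weight zero only the subsets of size `n - 1` contribute to `Φⁿ`. -/
theorem Phi_weight_zero_apply (T : A →ₗ[k] A) (n : ℕ) (f : Cochain k A A n) (a : Fin n → A) :
    Phi (0 : k) T n f a = f (fun i => T (a i)) -
      ∑ i, T (f (Function.update (fun j => T (a j)) i (a i))) := by
  rw [Phi_apply]
  congr 1
  have hinj : Function.Injective fun i : Fin n => (Finset.univ : Finset (Fin n)).erase i := by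
    intro i j h
    by_contra hij
    have : j ∈ (Finset.univ : Finset (Fin n)).erase i := by simp [Ne.symm hij]
    simp [show (Finset.univ : Finset (Fin n)).erase i = Finset.univ.erase j from h] at this
  rw [← Finset.sum_subset (s₁ := Finset.univ.image fun i : Fin n => Finset.univ.erase i),
    Finset.sum_image fun i _ j _ h => hinj h]
  · refine Finset.sum_congr rfl fun i _ => ?_
    rw [Finset.card_erase_of_mem (Finset.mem_univ i), Finset.card_univ, Fintype.card_fin,
      Nat.sub_self, pow_zero, one_smul]
    congr 2
    funext j
    by_cases h : j = i
    · subst h; simp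
    · simp [h]
  · intro S hS
    obtain ⟨i, -, rfl⟩ := Finset.mem_image.1 hS
    exact Finset.mem_ssubsets.2 (Finset.erase_ssubset (Finset.mem_univ i))
  · intro S hS hS'
    rw [Finset.mem_ssubsets] at hS
    have h1 : S.card < n := by simpa using Finset.card_lt_card hS
    have h2 : n - 1 - S.card ≠ 0 := by
      intro h
      obtain ⟨i, -, hi⟩ := Finset.exists_of_ssubset hS
      refine hS' (Finset.mem_image.2 ⟨i, Finset.mem_univ i, ?_⟩)
      refine (Finset.eq_of_subset_of_card_le (fun j hj => ?_) ?_).symm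
      · simp only [Finset.mem_erase, Finset.mem_univ, and_true]
        rintro rfl
        exact hi hj
      · rw [Finset.card_erase_of_mem (Finset.mem_univ i), Finset.card_univ, Fintype.card_fin]
        omega
    rw [zero_pow h2, zero_smul]

/-- The recursion for `Φ` in weight zero. -/
theorem curryLeft_Phi (T : A →ₗ[k] A) {n : ℕ} (f : Cochain k A A (n + 1)) (a : A) :
    (Phi (0 : k) T (n + 1) f).curryLeft a = Phi (0 : k) T n (f.curryLeft (T a)) -
      T.compMultilinearMap ((f.curryLeft a).compLinearMap fun _ => T) := by
  have h : ∀ b : Fin n → A, (fun i => T ((Fin.cons a b : Fin (n + 1) → A) i)) =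
      (Fin.cons (T a) fun i => T (b i) : Fin (n + 1) → A) := by
    intro b
    funext i
    refine Fin.cases ?_ (fun i => ?_) i <;> simp
  ext b
  simp only [MultilinearMap.curryLeft_apply, Phi_weight_zero_apply, sub_apply, h,
    Fin.sum_univ_succ, Fin.cons_zero, Fin.cons_succ, Fin.update_cons_zero,
    ← Fin.cons_update, LinearMap.compMultilinearMap_apply, MultilinearMap.compLinearMap_apply]
  abel

/-- In weight zero, `Φ` is a morphism of Hochschild complexes, for coefficients in the bimodule
over `A` with underlying right module `A` and a left action `l` satisfying the Rota–Baxter relation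
with `T`. The generality in `l` is what the induction on the degree needs, as its step passes from
`l` to the left action zero. -/
theorem IsRotaBaxterOperator.hochschildD_Phi {T : A →ₗ[k] A}
    (hT : IsRotaBaxterOperator (0 : k) T) {l : A →ₗ[k] A →ₗ[k] A} {l' : A →ₗ[k] A →ₗ[k] A}
    (hl : ∀ a x, l (T a) (T x) = T (l a (T x)) + T (l (T a) x))
    (hl' : ∀ a x, l' a x = l (T a) x - T (l a x)) (n : ℕ) (f : Cochain k A A n) :
    hochschildD (starMul 0 T) l' (rightAct T) n (Phi (0 : k) T n f) =
      Phi (0 : k) T (n + 1) (hochschildD (LinearMap.mul k A) l (LinearMap.mul k A) n f) := by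
  induction n generalizing l l' with
  | zero =>
    refine cochain_ext_curryLeft fun a => ?_
    rw [curryLeft_Phi]
    ext b
    simp [hochschildD_zero_apply _ _ _ _ _ Fin.elim0, Phi_zero, hl']
    abel
  | succ n ih =>
    refine cochain_ext_curryLeft fun a => ?_
    have hP : hochschildD (starMul 0 T) 0 (rightAct T) n
        (T.compMultilinearMap ((f.curryLeft a).compLinearMap fun _ => T)) =
        T.compMultilinearMap
          ((hochschildD (LinearMap.mul k A) 0 (LinearMap.mul k A) n
            (f.curryLeft a)).compLinearMap fun _ => T) :=
      hochschildD_naturality T T hT.map_starMul (by simp) (fun x a => by simp [hT x a]) _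
    have hact : (l' a).compMultilinearMap (Phi (0 : k) T (n + 1) f) =
        Phi (0 : k) T (n + 1) ((l (T a)).compMultilinearMap f) -
          T.compMultilinearMap (((l a).compMultilinearMap f).compLinearMap fun _ => T) := by
      ext b
      simp only [LinearMap.compMultilinearMap_apply, Phi_weight_zero_apply, sub_apply,
        MultilinearMap.compLinearMap_apply, map_sub, map_sum, hl', hl,
        Finset.sum_add_distrib]
      abel
    have hmul : (Phi (0 : k) T (n + 1) f).mulFirst (starMul 0 T) a =
        Phi (0 : k) T (n + 1) (f.mulFirst (LinearMap.mul k A) (T a)) -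
          T.compMultilinearMap ((f.mulFirst (LinearMap.mul k A) a).compLinearMap fun _ => T) := by
      refine cochain_ext_curryLeft fun b => ?_
      have hcons : ∀ g : Cochain k A A (n + 1),
          (T.compMultilinearMap (g.compLinearMap fun _ => T)).curryLeft b =
            T.compMultilinearMap ((g.curryLeft (T b)).compLinearMap fun _ => T) := by
        intro g
        ext v
        simp only [MultilinearMap.curryLeft_apply, LinearMap.compMultilinearMap_apply,
          MultilinearMap.compLinearMap_apply]
        congr 2
        funext i
        refine Fin.cases ?_ (fun i => ?_) i <;> simp
      rw [curryLeft_mulFirst, curryLeft_Phi, hT.map_starMul]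
      change _ = (Phi (0 : k) T (n + 1) (f.mulFirst (LinearMap.mul k A) (T a))).curryLeft b -
        (T.compMultilinearMap
          ((f.mulFirst (LinearMap.mul k A) a).compLinearMap fun _ => T)).curryLeft b
      rw [hcons]
      rw [curryLeft_Phi, curryLeft_mulFirst, curryLeft_mulFirst, curryLeft_mulFirst]
      ext v
      simp
      abel
    rw [curryLeft_hochschildD, curryLeft_Phi, curryLeft_Phi, curryLeft_hochschildD,
      curryLeft_hochschildD, map_sub, ih (l := 0) (l' := 0) (by simp) (by simp), hP, hact, hmul,
      map_add, map_smul, map_sub]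
    ext b
    simp [smul_sub]
    abel

theorem IsRotaBaxterOperator.dRBO_Phi {T : A →ₗ[k] A}
    (hT : IsRotaBaxterOperator (0 : k) T) (n : ℕ) (f : Cochain k A A n) :
    dRBO 0 T n (Phi (0 : k) T n f) = Phi (0 : k) T (n + 1) (dAlg k A n f) :=
  hT.hochschildD_Phi (fun a x => by simpa using hT a x) (fun _ _ => rfl) n f

end Operators

/-! ### Hochschild cohomology of algebras with one generator -/

section Monogenic

variable {k A M : Type*} [CommRing k] [AddCommGroup A] [Module k A] [AddCommGroup M] [Module k M]
  {m : A →ₗ[k] A →ₗ[k] A} {l : A →ₗ[k] M →ₗ[k] M} {r : M →ₗ[k] A →ₗ[k] M}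

/-- A cocycle vanishes if it does so with first argument the generator `g` or the initial element
`b 0` of a basis on which multiplication by `g` acts as the shift: by the cocycle condition it is
linear for multiplication by `g` in its first argument. -/
theorem eq_zero_of_hochschildD_eq_zero (b : Module.Basis ℕ k A) {g : A}
    (hb : ∀ j, b (j + 1) = m g (b j)) {n : ℕ} {f : Cochain k A M (n + 1)}
    (hf : hochschildD m l r (n + 1) f = 0) (hg : f.curryLeft g = 0)
    (h0 : f.curryLeft (b 0) = 0) : f = 0 := by
  have hgf : (l g).compMultilinearMap f = f.mulFirst m g := by
    have h := curryLeft_hochschildD m l r f g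
    rw [hf, hg, map_zero, add_zero] at h
    rw [← sub_eq_zero]
    exact (((isUnit_one.neg : IsUnit (-1 : k)).pow n).smul_eq_zero).1 h.symm
  have hj : ∀ j, f.curryLeft (b j) = 0 := by
    intro j
    induction j with
    | zero => exact h0
    | succ j ih =>
      rw [hb, ← curryLeft_mulFirst, ← hgf]
      ext v
      simpa using congrArg (l g) (DFunLike.congr_fun ih v)
  have h : f.curryLeft = 0 := b.ext fun j => by simpa using hj j
  exact cochain_ext_curryLeft fun a => by rw [h]; rfl

/-- The recursion along the basis that makes `δh` agree with `f` when the first argument is the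
generator `g`, up to a term in `h(g, …)`. -/
theorem exists_mulFirst_eq (l : A →ₗ[k] M →ₗ[k] M) (b : Module.Basis ℕ k A) {g : A}
    (hb : ∀ j, b (j + 1) = m g (b j)) {n : ℕ} (f : Cochain k A M (n + 2)) :
    ∃ h : Cochain k A M (n + 1), h.curryLeft (b 0) = 0 ∧
      h.mulFirst m g = (l g).compMultilinearMap h - (-1 : k) ^ n • f.curryLeft g := by
  let v : ℕ → Cochain k A M n := fun j => Nat.rec 0
    (fun j v => (l g).compMultilinearMap v - (-1 : k) ^ n • (f.curryLeft g).curryLeft (b j)) j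
  refine ⟨LinearMap.uncurryLeft (M := fun _ : Fin (n + 1) => A) (b.constr k v), ?_, ?_⟩
  · ext w
    simp [v]
  · have key : (LinearMap.uncurryLeft (M := fun _ : Fin (n + 1) => A)
        (b.constr k v)).curryLeft ∘ₗ m g =
        ((l g).compMultilinearMap (LinearMap.uncurryLeft (M := fun _ : Fin (n + 1) => A)
          (b.constr k v)) - (-1 : k) ^ n • f.curryLeft g).curryLeft := by
      refine b.ext fun j => ?_
      rw [LinearMap.comp_apply, ← hb]
      ext w
      simp [v]
    refine cochain_ext_curryLeft fun a => ?_
    rw [curryLeft_mulFirst]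
    exact LinearMap.congr_fun key a

theorem curryLeft_hochschildD_of_mulFirst_eq {g : A} {n : ℕ} {f : Cochain k A M (n + 2)}
    {h : Cochain k A M (n + 1)}
    (hh : h.mulFirst m g = (l g).compMultilinearMap h - (-1 : k) ^ n • f.curryLeft g) :
    (hochschildD m l r (n + 1) h).curryLeft g =
      f.curryLeft g + hochschildD m 0 r n (h.curryLeft g) := by
  rw [curryLeft_hochschildD, hh, sub_sub_cancel, smul_smul, ← mul_pow]
  simp

/-- Hochschild cohomology vanishes in degrees at least two for a non-unital algebra with basis the
powers `b 0, (b 0)², …` of an element. -/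
theorem exists_hochschildD_eq_of_powers (b : Module.Basis ℕ k A)
    (hb : ∀ j, b (j + 1) = m (b 0) (b j))
    (hd : ∀ (n : ℕ) (f : Cochain k A M n), hochschildD m l r (n + 1) (hochschildD m l r n f) = 0)
    {n : ℕ} {f : Cochain k A M (n + 2)} (hf : hochschildD m l r (n + 2) f = 0) :
    ∃ h, hochschildD m l r (n + 1) h = f := by
  obtain ⟨h, h0, hh⟩ := exists_mulFirst_eq l b hb f
  have hg : (f - hochschildD m l r (n + 1) h).curryLeft (b 0) = 0 := by
    change f.curryLeft (b 0) - (hochschildD m l r (n + 1) h).curryLeft (b 0) = 0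
    rw [curryLeft_hochschildD_of_mulFirst_eq hh, h0, LinearMap.map_zero, add_zero, sub_self]
  exact ⟨h, (sub_eq_zero.1 (eq_zero_of_hochschildD_eq_zero (l := l) (r := r) b hb
    (by rw [map_sub, hf, hd, sub_zero]) hg hg)).symm⟩

theorem mulFirst_of_left_unit {u : A} (hu : ∀ a, m u a = a) {n : ℕ}
    (f : Cochain k A M (n + 1)) : f.mulFirst m u = f :=
  cochain_ext_curryLeft fun a => by rw [curryLeft_mulFirst, hu]

theorem compMultilinearMap_of_left_unit {u : A} (hlu : ∀ x, l u x = x) {n : ℕ}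
    (f : Cochain k A M n) : (l u).compMultilinearMap f = f := by
  ext v
  simp [hlu]

theorem curryLeft_hochschildD_of_left_unit {u : A} (hu : ∀ a, m u a = a) (hlu : ∀ x, l u x = x)
    {n : ℕ} (f : Cochain k A M (n + 1)) :
    (hochschildD m l r (n + 1) f).curryLeft u = hochschildD m 0 r n (f.curryLeft u) := by
  rw [curryLeft_hochschildD, mulFirst_of_left_unit hu, compMultilinearMap_of_left_unit hlu,
    sub_self, smul_zero, zero_add]

/-- A cocycle on a unital algebra can be changed by a coboundary so that it vanishes when its first
argument is the unit. -/
theorem exists_curryLeft_sub_hochschildD_eq_zero {u : A} (hu : ∀ a, m u a = a)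
    (hlu : ∀ x, l u x = x) {n : ℕ} {f : Cochain k A M (n + 2)}
    (hf : hochschildD m l r (n + 2) f = 0) :
    ∃ h, (f - hochschildD m l r (n + 1) h).curryLeft u = 0 := by
  have h0 : hochschildD m 0 r (n + 1) (f.curryLeft u) = 0 := by
    rw [← curryLeft_hochschildD_of_left_unit hu hlu, hf]
    rfl
  -- The cocycle condition with first argument `u` leaves only `u ⬝ f(u, …)` in `δ(f(u, …))`.
  refine ⟨(-1 : k) ^ n • f.curryLeft u, ?_⟩
  change f.curryLeft u - (hochschildD m l r (n + 1) ((-1 : k) ^ n • f.curryLeft u)).curryLeft u = 0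
  rw [hochschildD_eq_left_add, map_smul, h0, compMultilinearMap_of_left_unit hlu, smul_smul,
    ← pow_add]
  have : (-1 : k) ^ (n + 1 + 1 + n) = 1 := Even.neg_one_pow ⟨n + 1, by ring⟩
  rw [this]
  ext v
  simp

/-- Hochschild cohomology vanishes in degrees at least two for a unital algebra with basis the
powers of an element `b 1`, starting from the unit `b 0`. -/
theorem exists_hochschildD_eq_of_unital_powers (b : Module.Basis ℕ k A)
    (hb : ∀ j, b (j + 1) = m (b 1) (b j)) (hu : ∀ a, m (b 0) a = a) (hlu : ∀ x, l (b 0) x = x)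
    (hd : ∀ (n : ℕ) (f : Cochain k A M n), hochschildD m l r (n + 1) (hochschildD m l r n f) = 0)
    {n : ℕ} {f : Cochain k A M (n + 2)} (hf : hochschildD m l r (n + 2) f = 0) :
    ∃ h, hochschildD m l r (n + 1) h = f := by
  obtain ⟨h₁, hh₁⟩ := exists_curryLeft_sub_hochschildD_eq_zero hu hlu hf
  set f' := f - hochschildD m l r (n + 1) h₁ with hf'_def
  have hf' : hochschildD m l r (n + 2) f' = 0 := by rw [map_sub, hf, hd, sub_zero]
  obtain ⟨h, h0, hh⟩ := exists_mulFirst_eq l b hb f'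
  -- The correction term in `(δh)(g, …)` is, up to sign, the differential of `f'(g, 1, …)` for the
  -- left action zero; it vanishes by the cocycle condition with first arguments `g, 1`.
  have hR : hochschildD m 0 r n ((f'.curryLeft (b 1)).curryLeft (b 0)) = 0 := by
    have h1 := curryLeft_hochschildD m l r f' (b 1)
    have h2 := congrArg (fun φ : Cochain k A M (n + 2) => φ.curryLeft (b 0)) h1
    have h3 : (((l (b 1)).compMultilinearMap f').curryLeft (b 0)) = 0 := by
      ext v
      simpa using congrArg (l (b 1)) (DFunLike.congr_fun hh₁ v)
    change ((hochschildD m l r (n + 2) f').curryLeft (b 1)).curryLeft (b 0) =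
      (-1 : k) ^ (n + 1) • (((l (b 1)).compMultilinearMap f').curryLeft (b 0) -
        (f'.mulFirst m (b 1)).curryLeft (b 0)) +
        (hochschildD m 0 r (n + 1) (f'.curryLeft (b 1))).curryLeft (b 0) at h2
    rw [hf', h3, curryLeft_mulFirst, ← hb 0, curryLeft_hochschildD, mulFirst_of_left_unit hu] at h2
    have h4 : ((0 : Cochain k A M (n + 3)).curryLeft (b 1)).curryLeft (b 0) = 0 := rfl
    have h5 : ((0 : A →ₗ[k] M →ₗ[k] M) (b 0)).compMultilinearMap (f'.curryLeft (b 1)) = 0 := rfl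
    rw [h4, h5, zero_add, pow_succ] at h2
    simpa using h2.symm
  have hg0 : h.curryLeft (b 1) = -((-1 : k) ^ n • (f'.curryLeft (b 1)).curryLeft (b 0)) := by
    rw [hb 0, ← curryLeft_mulFirst m (b 1) (b 0) h, hh, ← hb 0]
    ext v
    simpa using congrArg (l (b 1)) (DFunLike.congr_fun h0 v)
  have hg : (f' - hochschildD m l r (n + 1) h).curryLeft (b 1) = 0 := by
    change f'.curryLeft (b 1) - (hochschildD m l r (n + 1) h).curryLeft (b 1) = 0
    rw [curryLeft_hochschildD_of_mulFirst_eq hh, hg0, map_neg, map_smul, hR]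
    simp
  have hg' : (f' - hochschildD m l r (n + 1) h).curryLeft (b 0) = 0 := by
    change f'.curryLeft (b 0) - (hochschildD m l r (n + 1) h).curryLeft (b 0) = 0
    rw [curryLeft_hochschildD_of_left_unit hu hlu, hh₁, h0, LinearMap.map_zero, sub_zero]
  have hz := eq_zero_of_hochschildD_eq_zero (l := l) (r := r) b hb
    (by rw [map_sub, hf', hd, sub_zero]) hg hg'
  refine ⟨h₁ + h, ?_⟩
  rw [map_add, ← sub_eq_zero.1 hz, hf'_def]
  abel

end Monogenic

/-! ### Polynomials and integration -/

section Polynomial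

variable {k : Type*} [Field k]

theorem integration_monomial (n : ℕ) (c : k) :
    integration k (monomial n c) = monomial (n + 1) (c / ((n : k) + 1)) := by
  simp [integration, Polynomial.lsum_apply, div_eq_inv_mul, Polynomial.smul_monomial]

theorem coeff_zero_integration (p : k[X]) : (integration k p).coeff 0 = 0 := by
  induction p using Polynomial.induction_on' with
  | add p q hp hq => simp [hp, hq]
  | monomial n c => simp [integration_monomial, coeff_monomial]

theorem exists_dAlg_eq {n : ℕ} {f : Cochain k k[X] k[X] (n + 2)}
    (hf : dAlg k k[X] (n + 2) f = 0) : ∃ h, dAlg k k[X] (n + 1) h = f :=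
  exists_hochschildD_eq_of_unital_powers (basisMonomials k)
    (fun j => by simp [monomial_mul_monomial, add_comm])
    (by simp) (by simp) dAlg_dAlg hf

theorem eq_cons_apply_zero (a : Fin 1 → k[X]) : a = ![a 0] := by
  funext j; fin_cases j; rfl

/-- Degree-zero cochains are cocycles, since `k[x]` is commutative. -/
theorem dAlg_zero_apply (f : Cochain k k[X] k[X] 0) : dAlg k k[X] 0 f = 0 := by
  ext a
  simp [dAlg, hochschildD_zero_apply _ _ _ _ _ Fin.elim0, mul_comm]

/-- Degree-zero cochains are cocycles, since the actions `▷` and `◁` agree on `k[x]`. -/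
theorem dRBO_zero_apply (f : Cochain k k[X] k[X] 0) : dRBO 0 (integration k) 0 f = 0 := by
  ext a
  simp [dRBO, hochschildD_zero_apply _ _ _ _ _ Fin.elim0, mul_comm]

/-- The derivation `p · d/dx` as a Hochschild cochain. -/
def derivCochain (p : k[X]) : Cochain k k[X] k[X] 1 :=
  (LinearMap.mul k k[X] p).compMultilinearMap
    (LinearMap.compMultilinearMap (derivative : k[X] →ₗ[k] k[X])
      (MultilinearMap.ofSubsingleton k k[X] k[X] (0 : Fin 1) LinearMap.id))

theorem derivCochain_apply (p : k[X]) (a : Fin 1 → k[X]) :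
    derivCochain p a = p * derivative (a 0) := rfl

theorem dAlg_one_apply (f : Cochain k k[X] k[X] 1) (a b : k[X]) :
    dAlg k k[X] 1 f ![a, b] = a * f ![b] - f ![a * b] + f ![a] * b := by
  have h1 : (fun j : Fin 1 => (![a, b] : Fin 2 → k[X]) j.succ) = ![b] := by
    funext j; fin_cases j; rfl
  have h2 : (fun j : Fin 1 => (![a, b] : Fin 2 → k[X]) j.castSucc) = ![a] := by
    funext j; fin_cases j; rfl
  have h3 : Fin.contractNth (Fin.castSucc (0 : Fin 1))
      (fun u v : k[X] => LinearMap.mul k k[X] u v) ![a, b] = ![a * b] := by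
    funext j; fin_cases j; rfl
  rw [dAlg, hochschildD_apply, h1, h2, Fin.sum_univ_one, h3]
  change (-1 : k) ^ 2 • (a * f ![b]) + (-1 : k) ^ 1 • f ![a * b] + f ![a] * b = _
  simp [sub_eq_add_neg]

theorem dAlg_derivCochain (p : k[X]) : dAlg k k[X] 1 (derivCochain p) = 0 := by
  refine MultilinearMap.ext fun a => ?_
  have ha : a = ![a 0, a 1] := by funext j; fin_cases j <;> rfl
  rw [ha, dAlg_one_apply]
  simp [derivCochain_apply, derivative_mul]
  ring

theorem Phi_one_apply (f : Cochain k k[X] k[X] 1) (a : k[X]) :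
    Phi (0 : k) (integration k) 1 f ![a] =
      f ![integration k a] - integration k (f ![a]) := by
  have h1 : (fun i : Fin 1 => integration k ((![a] : Fin 1 → k[X]) i)) = ![integration k a] := by
    funext j; fin_cases j; rfl
  have h2 : Function.update (![integration k a] : Fin 1 → k[X]) 0 a = ![a] := by
    funext j; fin_cases j; rfl
  rw [Phi_weight_zero_apply, h1, Fin.sum_univ_one]
  change _ - integration k (f (Function.update ![integration k a] 0 a)) = _
  rw [h2]

variable [CharZero k]

theorem derivative_integration (p : k[X]) : derivative (integration k p) = p := by
  induction p using Polynomial.induction_on' with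
  | add p q hp hq => simp [hp, hq]
  | monomial n c =>
    have : (n : k) + 1 ≠ 0 := Nat.cast_add_one_ne_zero n
    simp [integration_monomial, this]

theorem integration_derivative (p : k[X]) :
    integration k (derivative p) = p - C (p.coeff 0) := by
  have h : derivative (integration k (derivative p) - (p - C (p.coeff 0))) = 0 := by
    simp [derivative_integration]
  have h' := eq_C_of_derivative_eq_zero h
  rw [← sub_eq_zero, h']
  simp [coeff_zero_integration]

theorem isRotaBaxterOperator_integration :
    IsRotaBaxterOperator (0 : k) (integration k) := by
  intro a b
  have h : derivative (integration k a * integration k b) =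
      a * integration k b + integration k a * b + (0 : k) • (a * b) := by
    simp [derivative_integration]
  rw [← h, integration_derivative, mul_coeff_zero, coeff_zero_integration]
  simp

/-- The basis `1, 2x, 3x², …` of `k[x]`: the powers of `1` for the product `⋆` of the integration
operator. -/
def starBasis (k : Type*) [Field k] [CharZero k] : Module.Basis ℕ k k[X] :=
  (basisMonomials k).isUnitSMul (w := fun j : ℕ => (j : k) + 1)
    fun j => (Nat.cast_add_one_ne_zero (R := k) j).isUnit

theorem starBasis_apply (j : ℕ) : starBasis k j = monomial j ((j : k) + 1) := by
  simp [starBasis, Module.Basis.isUnitSMul_apply, smul_monomial]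

theorem starBasis_zero : starBasis k 0 = 1 := by
  simp [starBasis_apply]

theorem starBasis_succ (j : ℕ) :
    starBasis k (j + 1) = starMul 0 (integration k) (starBasis k 0) (starBasis k j) := by
  have h : integration k (1 : k[X]) = monomial 1 1 := by
    rw [← monomial_zero_one, integration_monomial]
    simp
  have : (j : k) + 1 ≠ 0 := Nat.cast_add_one_ne_zero j
  rw [starBasis_zero]
  simp only [starMul_apply, starBasis_apply, integration_monomial, h, monomial_mul_monomial,
    one_mul, zero_smul, add_zero, div_self this, add_comm 1 j, ← map_add, Nat.cast_succ]
  rw [add_comm (1 : k)]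

theorem exists_dRBO_eq {n : ℕ} {g : Cochain k k[X] k[X] (n + 2)}
    (hg : dRBO 0 (integration k) (n + 2) g = 0) :
    ∃ h, dRBO 0 (integration k) (n + 1) h = g :=
  exists_hochschildD_eq_of_powers (starBasis k) starBasis_succ
    isRotaBaxterOperator_integration.dRBO_dRBO hg

/-- A derivation `f` of `k[x]` that commutes with integration vanishes: `f(1) = 0`, hence
`f(x) = f(∫ 1) = ∫ f(1) = 0`. -/
theorem eq_zero_of_Phi_one_eq_zero {f : Cochain k k[X] k[X] 1} (hf : dAlg k k[X] 1 f = 0)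
    (hΦ : Phi (0 : k) (integration k) 1 f = 0) : f = 0 := by
  have h1 : f.curryLeft 1 = 0 := by
    refine MultilinearMap.ext fun v => ?_
    have h := dAlg_one_apply f 1 1
    rw [hf] at h
    rw [MultilinearMap.curryLeft_apply, eq_cons_apply_zero (Fin.cons 1 v : Fin 1 → k[X])]
    simpa using h.symm
  have hX : f.curryLeft X = 0 := by
    refine MultilinearMap.ext fun v => ?_
    have h := Phi_one_apply f 1
    have h' : f ![1] = 0 := by
      have := DFunLike.congr_fun h1 ![]
      rwa [MultilinearMap.curryLeft_apply, eq_cons_apply_zero (Fin.cons 1 _ : Fin 1 → k[X])] at this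
    have hT : integration k 1 = X := by simpa using integration_X_pow k 0
    rw [hΦ, h', hT] at h
    rw [MultilinearMap.curryLeft_apply, eq_cons_apply_zero (Fin.cons X v : Fin 1 → k[X])]
    simpa using h.symm
  exact eq_zero_of_hochschildD_eq_zero (basisMonomials k) (g := X)
    (fun j => by simp [X_mul_monomial]) hf hX (by simpa using h1)

/-- Every `1`-cocycle `g` of `C_RBO` is the image under `Φ` of a derivation of `k[x]`. As `1`
generates `k[x]` for the product `⋆`, it suffices to compare values at `1`, and `Φ(p · d/dx)`
takes the value `p` there. -/
theorem Phi_derivCochain_eq {g : Cochain k k[X] k[X] 1} (hg : dRBO 0 (integration k) 1 g = 0) :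
    Phi (0 : k) (integration k) 1 (derivCochain (g ![1])) = g := by
  have hv : (Phi (0 : k) (integration k) 1 (derivCochain (g ![1])) - g).curryLeft
      (starBasis k 0) = 0 := by
    ext v
    rw [MultilinearMap.curryLeft_apply, eq_cons_apply_zero (Fin.cons _ v : Fin 1 → k[X]), sub_apply,
      Fin.cons_zero, starBasis_zero, Phi_one_apply]
    simp [derivCochain_apply, derivative_integration]
  refine sub_eq_zero.1 (eq_zero_of_hochschildD_eq_zero (l := leftAct (integration k))
    (r := rightAct (integration k)) (starBasis k) starBasis_succ ?_ hv hv)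
  change dRBO 0 (integration k) 1 _ = 0
  rw [map_sub, hg, isRotaBaxterOperator_integration.dRBO_Phi, dAlg_derivCochain, map_zero,
    sub_zero]

/-- In positive degree, the cone of `Φ` is exact. -/
theorem exists_dRBA_eq {n : ℕ} {x : RBACochain k k[X] (n + 1)}
    (hx : dRBA (0 : k) (integration k) (n + 1) x = 0) :
    ∃ y, dRBA (0 : k) (integration k) n y = x := by
  obtain ⟨f, g⟩ := x
  have hf : dAlg k k[X] (n + 1) f = 0 := congrArg Prod.fst hx
  have hg : -dRBO 0 (integration k) n g - Phi 0 (integration k) (n + 1) f = 0 :=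
    congrArg Prod.snd hx
  match n with
  | 0 =>
    rw [dRBO_zero_apply, neg_zero, zero_sub, neg_eq_zero] at hg
    refine ⟨-g, Prod.ext ?_ ?_⟩
    · change dAlg k k[X] 0 (-g) = f
      rw [dAlg_zero_apply, eq_zero_of_Phi_one_eq_zero hf hg]
    · change (-Phi 0 (integration k) 0) (-g) = g
      simp [Phi_zero]
  | n + 1 =>
    obtain ⟨h, rfl⟩ := exists_dAlg_eq hf
    -- Choosing a primitive `h` of `f`, the obstruction to lifting `g` is the class of `g + Φ h`.
    have hγ : dRBO 0 (integration k) (n + 1) (g + Phi 0 (integration k) (n + 1) h) = 0 := by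
      rw [map_add, isRotaBaxterOperator_integration.dRBO_Phi, ← neg_eq_zero, ← hg]
      abel
    match n with
    | 0 =>
      -- The class of the obstruction is the image of a derivation, by which `h` can be changed.
      have hp := Phi_derivCochain_eq hγ
      set p := derivCochain ((g + Phi 0 (integration k) 1 h) ![1]) with hp_def
      refine ⟨(h - p, 0), Prod.ext ?_ ?_⟩
      · change dAlg k k[X] 1 (h - p) = dAlg k k[X] 1 h
        rw [map_sub, dAlg_derivCochain, sub_zero]
      · change -dRBO 0 (integration k) 0 0 - Phi 0 (integration k) 1 (h - p) = g
        rw [map_zero, map_sub, hp]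
        abel
    | n + 1 =>
      obtain ⟨q, hq⟩ := exists_dRBO_eq hγ
      refine ⟨(h, -q), Prod.ext rfl ?_⟩
      change -dRBO 0 (integration k) (n + 1) (-q) - Phi 0 (integration k) (n + 2) h = g
      rw [map_neg, neg_neg, hq, add_sub_cancel_right]

theorem RBACocycles_le_RBACoboundaries (n : ℕ) :
    RBACocycles (0 : k) (integration k) n ≤ RBACoboundaries (0 : k) (integration k) n := by
  intro x hx
  cases n with
  | zero =>
    have h : ∀ y : Cochain k k[X] k[X] 0, (-Phi (0 : k) (integration k) 0) y = 0 → y = 0 := by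
      intro y hy
      rwa [LinearMap.neg_apply, neg_eq_zero, Phi_zero] at hy
    exact h x (congrArg Prod.snd hx)
  | succ n => exact exists_dRBA_eq hx

end Polynomial

end RotaBaxter

end

theorem mainTheorem8 {k : Type*} [Field k] [CharZero k] :
    RotaBaxter.IsRotaBaxterOperator (0 : k) (RotaBaxter.integration k) ∧
      ∀ n : ℕ, Subsingleton (RotaBaxter.RBACohomology (0 : k) (RotaBaxter.integration k) n) := by
  refine ⟨RotaBaxter.isRotaBaxterOperator_integration, fun n => ?_⟩
  rw [Submodule.Quotient.subsingleton_iff, Submodule.submoduleOf_eq_top]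
  exact RotaBaxter.RBACocycles_le_RBACoboundaries n
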